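/- Let $G=(V,E)$ be a finite connected undirected graph with node costs $c\colon V\to\mathbb R_{\ge 0}$ and let $b\ge 0$ be a budget. For distinct $s,t\in V$ let $\sigma_{s,t}$ be the number of shortest $s$–$t$ paths and, for $C\subseteq V$, let $\sigma_{s,t}(C)$ be the number of those that contain at least one node of $C$ (endpoints included). Put $$\operatorname{GBC}(C)=\sum_{s,t\in V,\ s\ne t}\frac{\sigma_{s,t}(C)}{\sigma_{s,t}},\qquad c(C)=\sum_{v\in C}c(v).$$ The Maximum Betweenness Centrality problem (MBC) asks for a set $C\subseteq V$ with $c(C)\le b$ that maximizes $\operatorname{GBC}(C)$. *Modified greedy algorithm.* Start with $H=\emptyset$. For each $C\subseteq V$ with $|C|\le 3$ and $c(C)\le b$ (in any order), set $U=V\setminus C$ and, while $U\neq\emptyset$, choose $u\in U$ maximizing $\bigl(\operatorname{GBC}(C\cup\{v\})-\operatorname{GBC}(C)\bigr)/c(v)$ over $v\in U$ (if $c(v)=0$, the quotient is $\infty$ when the numerator is positive and $0$ otherwise), add $u$ to $C$ if $c(C\cup\{u\})\le b$, and remove $u$ from $U$; afterwards, if $\operatorname{GBC}(C)>\operatorname{GBC}(H)$,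 replace $H$ by $C$. Return $H$. *Greedy algorithm of Dolev et al.* (unit costs $c\equiv 1$, budget $b=k\le|V|$). Start with $C=\emptyset$ and, $k$ times, add to $C$ a node $v\notin C$ maximizing $\operatorname{GBC}(C\cup\{v\})$. Return $C$. In both algorithms ties are broken arbitrarily. A number $\rho$ is an approximation factor of an algorithm if on every instance every possible output is feasible and has centrality at least $\rho$ times the optimum. **Theorem.** The approximation factor $1-1/e$ is tight for both algorithms: $1-1/e$ is the largest approximation factor of the modified greedy algorithm for MBC, and it is the largest approximation factor of the greedy algorithm of Dolev et al. for unit-cost MBC. Moreover, tightness is witnessed by unit-cost instances common to both algorithms: for every $\varepsilon>0$ there is a finite connected graph with unit costs and an integer budget $k\le|V|$, with positive optimum $\mathrm{OPT}$, such that both algorithms have an output on it and every possible output $H$ of either algorithm satisfies $$\left|\frac{\operatorname{GBC}(H)}{\mathrm{OPT}}-\Bigl(1-\frac1e\Bigr)\right|<\varepsilon .$$ -/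

import Mathlib

open scoped ENNReal

namespace MBC

variable {V : Type} [Fintype V] [DecidableEq V]

/-- The set of shortest `s`-`t` paths. A walk whose length is the distance of its ends is
automatically a path. -/
def shortestPaths (G : SimpleGraph V) (s t : V) : Set (G.Walk s t) :=
  {p | p.length = G.dist s t}

/-- There are only finitely many shortest paths, so that counting them by `Set.ncard` below is the
true cardinality. -/
theorem shortestPaths_finite (G : SimpleGraph V) (s t : V) : (shortestPaths G s t).Finite := by
  classical
  exact Set.toFinite {p : G.Walk s t | p.length = G.dist s t}

/-- The number of shortest `s`-`t` paths. -/
noncomputable def sigma (G : SimpleGraph V) (s t : V) : ℕ :=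
  (shortestPaths G s t).ncard

/-- The number of shortest `s`-`t` paths that contain at least one node of `C` (the ends `s` and `t`
count as nodes of the path). -/
noncomputable def sigmaThrough (G : SimpleGraph V) (C : Finset V) (s t : V) : ℕ :=
  {p ∈ shortestPaths G s t | ∃ v ∈ C, v ∈ p.support}.ncard

/-- Group betweenness centrality: the sum over all ordered pairs of distinct nodes `s`, `t` of the
fraction of shortest `s`-`t` paths that are met by `C`. -/
noncomputable def GBC (G : SimpleGraph V) (C : Finset V) : ℝ :=
  ∑ p ∈ (Finset.univ : Finset V).offDiag,
    (sigmaThrough G C p.1 p.2 : ℝ) / (sigma G p.1 p.2 : ℝ)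

/-- The total cost of a node set. -/
def cost (c : V → ℝ) (C : Finset V) : ℝ := ∑ v ∈ C, c v

/-- The relative gain `(GBC (C + v) - GBC C) / c v` as an element of `[0, ∞]`: for a node of cost
zero it is `∞` if the gain is positive and `0` if there is no gain. -/
noncomputable def relGain (G : SimpleGraph V) (c : V → ℝ) (C : Finset V) (v : V) : ℝ≥0∞ :=
  ENNReal.ofReal (GBC G (insert v C) - GBC G C) / ENNReal.ofReal (c v)

/-- `u` is an arg max of the relative gain over `U` (ties may be broken in any way). -/
def IsBest (G : SimpleGraph V) (c : V → ℝ) (C U : Finset V) (u : V) : Prop :=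
  u ∈ U ∧ ∀ v ∈ U, relGain G c C v ≤ relGain G c C u

/-- `AugmentLoop G c b C U C'`: the while-loop of the modified greedy algorithm, started with the
current set `C` and the set `U` of nodes not yet considered, can end with the set `C'`. Each
iteration takes the best `u ∈ U`, adds it to `C` if the budget permits, and removes it from `U`. -/
inductive AugmentLoop (G : SimpleGraph V) (c : V → ℝ) (b : ℝ) :
    Finset V → Finset V → Finset V → Prop
  | done (C : Finset V) : AugmentLoop G c b C ∅ C
  | take {C U C' : Finset V} {u : V} (hu : IsBest G c C U u) (hb : cost c (insert u C) ≤ b)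
      (h : AugmentLoop G c b (insert u C) (U.erase u) C') : AugmentLoop G c b C U C'
  | skip {C U C' : Finset V} {u : V} (hu : IsBest G c C U u) (hb : ¬ cost c (insert u C) ≤ b)
      (h : AugmentLoop G c b C (U.erase u) C') : AugmentLoop G c b C U C'

/-- `ModifiedGreedy G c b H`: some run of the modified (budgeted) greedy algorithm returns `H`.
Every set `C` with at most three nodes and `c(C) ≤ b` is visited exactly once, in some order, and
augmented to `run C` by the while-loop started with `U = V \ C`; the variable `H`, initially empty,
is replaced by `run C` whenever this has larger centrality. -/
def ModifiedGreedy (G : SimpleGraph V) (c : V → ℝ) (b : ℝ) (H : Finset V) : Prop :=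
  ∃ (order : List (Finset V)) (run : Finset V → Finset V),
    order.Nodup ∧
    (∀ C : Finset V, C ∈ order ↔ C.card ≤ 3 ∧ cost c C ≤ b) ∧
    (∀ C ∈ order, AugmentLoop G c b C (Finset.univ \ C) (run C)) ∧
    H = order.foldl (fun H C => if GBC G (run C) > GBC G H then run C else H) ∅

/-- `UnitGreedy G k H`: some run of the greedy algorithm for the unit-cost problem yields `H` after
`k` steps. It starts with the empty set, and each step adds a new node `v` that maximizes
`GBC (C + v)`; ties may be broken in any way. -/
inductive UnitGreedy (G : SimpleGraph V) : ℕ → Finset V → Prop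
  | start : UnitGreedy G 0 ∅
  | step {k : ℕ} {C : Finset V} {v : V} (h : UnitGreedy G k C) (hv : v ∉ C)
      (hmax : ∀ w, w ∉ C → GBC G (insert w C) ≤ GBC G (insert v C)) :
      UnitGreedy G (k + 1) (insert v C)

/-- `O` is an optimal solution of the budgeted problem. -/
def IsOptimal (G : SimpleGraph V) (c : V → ℝ) (b : ℝ) (O : Finset V) : Prop :=
  cost c O ≤ b ∧ ∀ C : Finset V, cost c C ≤ b → GBC G C ≤ GBC G O

/-- The modified greedy algorithm is a factor-`ρ` approximation for budgeted MBC: on every instance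
every possible output is a feasible solution with at least `ρ` times the optimal centrality. -/
def ModifiedGreedyHasFactor (ρ : ℝ) : Prop :=
  ∀ (V : Type) [Fintype V] [DecidableEq V] (G : SimpleGraph V) (c : V → ℝ) (b : ℝ),
    G.Connected → (∀ v, 0 ≤ c v) → 0 ≤ b →
    ∀ H, ModifiedGreedy G c b H →
      cost c H ≤ b ∧ ∀ O, IsOptimal G c b O → ρ * GBC G O ≤ GBC G H

/-- The greedy algorithm is a factor-`ρ` approximation for unit-cost MBC with budget `k`. -/
def UnitGreedyHasFactor (ρ : ℝ) : Prop :=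
  ∀ (V : Type) [Fintype V] [DecidableEq V] (G : SimpleGraph V) (k : ℕ),
    G.Connected → k ≤ Fintype.card V →
    ∀ H, UnitGreedy G k H →
      cost (fun _ => 1) H ≤ k ∧ ∀ O, IsOptimal G (fun _ => 1) k O → ρ * GBC G O ≤ GBC G H

end MBC

set_option linter.unusedSectionVars false

namespace MBC

variable {V : Type} [Fintype V] [DecidableEq V]

/-! ### Group betweenness centrality is monotone and submodular -/

section Centrality

/-! Centrality is a weighted count of shortest paths met by a set, hence monotone and submodular. By
`gap_mul_cost_le`, a node of best relative gain closes a share of the gap to the optimum `O`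
proportional to its cost, so the gap decays exponentially in the cost spent (`gap_decay_step`). For
unit costs this gives the factor at once. In the budgeted case a run may skip a node of `O`;
enumerating the seeds makes one run start from the three greedily best nodes `Y` of `O`, and the
skipped node then gains at most `GBC G Y / 3`. This loss is affordable because `1/3 ≤ 1/e`.

For tightness, maximum coverage of a grid is encoded as a graph. The shortest path from a source to
a target is unique and passes through one column and one row; with many sources these pairs dominate
all others. The `m + 4` columns together meet every such pair and are nearly optimal. The row
weights `t` are chosen so that a row beats every column as long as `m + 1` columns are free
(`IsTight.exists_eq_row`). A seed of at most three nodes cannot destroy this condition, so both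
algorithms go on choosing rows until the budget is spent. They miss a fraction of about `((m - 1) /
m) ^ (m + 4)` of the pairs, which tends to `1/e`. -/

theorem sigmaThrough_mono (G : SimpleGraph V) {A B : Finset V} (h : A ⊆ B) (s t : V) :
    sigmaThrough G A s t ≤ sigmaThrough G B s t := by
  refine Set.ncard_le_ncard ?_ ((shortestPaths_finite G s t).subset fun p hp => hp.1)
  rintro p ⟨hp, v, hv, hvp⟩
  exact ⟨hp, v, h hv, hvp⟩

theorem sigmaThrough_le_sigma (G : SimpleGraph V) (C : Finset V) (s t : V) :
    sigmaThrough G C s t ≤ sigma G s t :=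
  Set.ncard_le_ncard (fun _ hp => hp.1) (shortestPaths_finite G s t)

/-- The newly covered shortest paths account for the increase of `sigmaThrough`. -/
theorem sigmaThrough_insert (G : SimpleGraph V) (C : Finset V) (u s t : V) :
    sigmaThrough G (insert u C) s t = sigmaThrough G C s t +
      {p ∈ shortestPaths G s t | u ∈ p.support ∧ ∀ v ∈ C, v ∉ p.support}.ncard := by
  have hfin := shortestPaths_finite G s t
  unfold sigmaThrough
  rw [← Set.ncard_union_eq _ (hfin.subset fun p hp => hp.1) (hfin.subset fun p hp => hp.1)]
  · congr 1
    ext p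
    simp only [Set.mem_ofPred_eq, Set.mem_union, Finset.mem_insert]
    constructor
    · rintro ⟨hp, v, rfl | hv, hvp⟩
      · by_cases h : ∃ w ∈ C, w ∈ p.support
        · exact Or.inl ⟨hp, h⟩
        · exact Or.inr ⟨hp, hvp, fun w hw hwp => h ⟨w, hw, hwp⟩⟩
      · exact Or.inl ⟨hp, v, hv, hvp⟩
    · rintro (⟨hp, v, hv, hvp⟩ | ⟨hp, hu, -⟩)
      · exact ⟨hp, v, Or.inr hv, hvp⟩
      · exact ⟨hp, u, Or.inl rfl, hu⟩
  · rw [Set.disjoint_left]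
    rintro p ⟨-, v, hv, hvp⟩ ⟨-, -, h⟩
    exact h v hv hvp

theorem GBC_mono (G : SimpleGraph V) {A B : Finset V} (h : A ⊆ B) : GBC G A ≤ GBC G B := by
  refine Finset.sum_le_sum fun p _ => ?_
  have := sigmaThrough_mono G h p.1 p.2
  gcongr

theorem GBC_nonneg (G : SimpleGraph V) (C : Finset V) : 0 ≤ GBC G C :=
  Finset.sum_nonneg fun _ _ => by positivity

/-- Diminishing returns. -/
theorem GBC_insert_sub_le (G : SimpleGraph V) {A B : Finset V} (h : A ⊆ B) (u : V) :
    GBC G (insert u B) - GBC G B ≤ GBC G (insert u A) - GBC G A := by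
  unfold GBC
  rw [← Finset.sum_sub_distrib, ← Finset.sum_sub_distrib]
  refine Finset.sum_le_sum fun p _ => ?_
  -- The gain of `u` counts the paths through `u` that avoid the present set; a larger set leaves
  -- fewer of them.
  rw [← sub_div, ← sub_div, sigmaThrough_insert, sigmaThrough_insert]
  push_cast
  rw [add_sub_cancel_left, add_sub_cancel_left]
  refine div_le_div_of_nonneg_right (Nat.cast_le.2 ?_) (Nat.cast_nonneg _)
  refine Set.ncard_le_ncard ?_
    ((shortestPaths_finite G p.1 p.2).subset fun p hp => hp.1)
  rintro q ⟨hq, hu, hB⟩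
  exact ⟨hq, hu, fun v hv => hB v (h hv)⟩

theorem GBC_union_sub_le (G : SimpleGraph V) (C D : Finset V) :
    GBC G (C ∪ D) - GBC G C ≤ ∑ v ∈ D, (GBC G (insert v C) - GBC G C) := by
  induction D using Finset.induction_on with
  | empty => simp
  | insert a D ha ih =>
    rw [Finset.sum_insert ha, Finset.union_insert]
    have := GBC_insert_sub_le G (Finset.subset_union_left (s₁ := C) (s₂ := D)) a
    linarith

/-- The gap to any set is at most the sum of the individual gains of its missing nodes. -/
theorem GBC_sub_le_sum_gain (G : SimpleGraph V) (C O : Finset V) :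
    GBC G O - GBC G C ≤ ∑ v ∈ O \ C, (GBC G (insert v C) - GBC G C) := by
  have h1 := GBC_union_sub_le G C (O \ C)
  have h2 : GBC G O ≤ GBC G (C ∪ O \ C) := GBC_mono G (by simp)
  linarith

theorem cost_insert (c : V → ℝ) {C : Finset V} {v : V} (h : v ∉ C) :
    cost c (insert v C) = c v + cost c C := Finset.sum_insert h

theorem cost_mono {c : V → ℝ} (hc : ∀ v, 0 ≤ c v) {A B : Finset V} (h : A ⊆ B) :
    cost c A ≤ cost c B :=
  Finset.sum_le_sum_of_subset_of_nonneg h fun v _ _ => hc v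

theorem cost_one (C : Finset V) : cost (fun _ => 1) C = C.card := by simp [cost]

/-- A node of largest relative gain closes at least the share `c u / (c O - c C)` of the gap. -/
theorem gap_mul_cost_le (G : SimpleGraph V) {c : V → ℝ} (hc : ∀ v, 0 ≤ c v) {C U O : Finset V}
    {u : V} (hu : IsBest G c C U u) (hO : O \ C ⊆ U) :
    c u * (GBC G O - GBC G C) ≤ cost c (O \ C) * (GBC G (insert u C) - GBC G C) := by
  have gain_nonneg : ∀ v, 0 ≤ GBC G (insert v C) - GBC G C := fun v =>
    sub_nonneg.2 (GBC_mono G (Finset.subset_insert v C))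
  rcases (hc u).eq_or_lt with h0 | hpos
  · rw [← h0, zero_mul]
    exact mul_nonneg (Finset.sum_nonneg fun v _ => hc v) (gain_nonneg u)
  have key : ∀ v ∈ O \ C, c u * (GBC G (insert v C) - GBC G C) ≤
      c v * (GBC G (insert u C) - GBC G C) := by
    intro v hv
    have h := hu.2 v (hO hv)
    unfold relGain at h
    rw [← ENNReal.ofReal_div_of_pos hpos] at h
    have hq : 0 ≤ (GBC G (insert u C) - GBC G C) / c u := div_nonneg (gain_nonneg u) hpos.le
    -- Since `c u > 0`, the best relative gain is finite, so a free node `v` cannot have positive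
    -- gain: its quotient would be `∞`.
    rcases (hc v).eq_or_lt with hv0 | hvpos
    · rw [← hv0, zero_mul]
      rw [← hv0, ENNReal.ofReal_zero] at h
      by_contra hcon
      have hg : 0 < GBC G (insert v C) - GBC G C := by
        by_contra hg
        exact hcon (mul_nonpos_of_nonneg_of_nonpos hpos.le (not_lt.1 hg))
      rw [ENNReal.div_zero (ENNReal.ofReal_pos.2 hg).ne'] at h
      exact ENNReal.ofReal_ne_top (top_le_iff.1 h)
    · rw [← ENNReal.ofReal_div_of_pos hvpos, ENNReal.ofReal_le_ofReal_iff hq,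
        div_le_div_iff₀ hvpos hpos] at h
      linarith
  calc c u * (GBC G O - GBC G C)
      ≤ c u * ∑ v ∈ O \ C, (GBC G (insert v C) - GBC G C) :=
        mul_le_mul_of_nonneg_left (GBC_sub_le_sum_gain G C O) hpos.le
    _ ≤ ∑ v ∈ O \ C, c v * (GBC G (insert u C) - GBC G C) := by
        rw [Finset.mul_sum]; exact Finset.sum_le_sum key
    _ = _ := by rw [← Finset.sum_mul]; rfl

end Centrality

/-! ### The factor of the modified greedy algorithm -/

section ModifiedGreedyFactor

theorem AugmentLoop.subset {G : SimpleGraph V} {c : V → ℝ} {b : ℝ} {C U C' : Finset V}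
    (h : AugmentLoop G c b C U C') : C ⊆ C' := by
  induction h with
  | done C => exact subset_rfl
  | take _ _ _ ih => exact (Finset.subset_insert _ _).trans ih
  | skip _ _ _ ih => exact ih

theorem AugmentLoop.cost_le {G : SimpleGraph V} {c : V → ℝ} {b : ℝ} {C U C' : Finset V}
    (h : AugmentLoop G c b C U C') (hC : cost c C ≤ b) : cost c C' ≤ b := by
  induction h with
  | done C => exact hC
  | take _ hb _ ih => exact ih hb
  | skip _ _ _ ih => exact ih hC

/-- One augmentation step preserves the exponential decay of the gap. -/
theorem gap_decay_step {Δ Δ₀ g x y B : ℝ} (hB : 0 < B) (hΔ₀ : 0 ≤ Δ₀) (hg : 0 ≤ g)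
    (hgain : x * Δ ≤ B * g) (hΔ : Δ ≤ Real.exp (-(y / B)) * Δ₀) :
    Δ - g ≤ Real.exp (-((x + y) / B)) * Δ₀ := by
  rcases le_or_gt Δ 0 with h | h
  · have : 0 ≤ Real.exp (-((x + y) / B)) * Δ₀ := by positivity
    linarith
  have h1 : x / B * Δ ≤ g := by
    rw [div_mul_eq_mul_div, div_le_iff₀ hB]; linarith
  have h2 : 1 - x / B ≤ Real.exp (-(x / B)) := by
    have := Real.add_one_le_exp (-(x / B)); linarith
  calc Δ - g ≤ (1 - x / B) * Δ := by linarith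
    _ ≤ Real.exp (-(x / B)) * Δ := mul_le_mul_of_nonneg_right h2 h.le
    _ ≤ Real.exp (-(x / B)) * (Real.exp (-(y / B)) * Δ₀) :=
        mul_le_mul_of_nonneg_left hΔ (Real.exp_pos _).le
    _ = _ := by rw [← mul_assoc, ← Real.exp_add]; congr 2; ring

/-- If all nodes of `O` outside the seed `Y` have gain at most `δ` over every superset of `Y`, then
the while-loop loses at most `δ` against the exponential-decay bound. -/
theorem AugmentLoop.le_GBC {G : SimpleGraph V} {c : V → ℝ} {b : ℝ} (hc : ∀ v, 0 ≤ c v)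
    {Y O C U C' : Finset V} {δ : ℝ} (hδ : 0 ≤ δ) (hO : cost c O ≤ b) (hYO : Y ⊆ O)
    (hgain : ∀ D, Y ⊆ D → ∀ v ∈ O \ Y, GBC G (insert v D) - GBC G D ≤ δ)
    (h : AugmentLoop G c b C U C') (hYC : Y ⊆ C) (hU : O \ C ⊆ U) (hdisj : Disjoint U C)
    (hb : cost c C ≤ b)
    (hinv : 0 < b - cost c Y → GBC G O - GBC G C ≤
      Real.exp (-((cost c C - cost c Y) / (b - cost c Y))) * (GBC G O - GBC G Y)) :
    GBC G O - Real.exp (-1) * (GBC G O - GBC G Y) - δ ≤ GBC G C' := by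
  have hgap : 0 ≤ GBC G O - GBC G Y := sub_nonneg.2 (GBC_mono G hYO)
  -- The decay passes to `insert u C` whether or not the budget admits `u`; the skip case needs it
  -- for a set that is never built.
  have step : ∀ {C U : Finset V} {u : V}, IsBest G c C U u → Y ⊆ C → O \ C ⊆ U → u ∉ C →
      (0 < b - cost c Y → GBC G O - GBC G C ≤
        Real.exp (-((cost c C - cost c Y) / (b - cost c Y))) * (GBC G O - GBC G Y)) →
      (0 < b - cost c Y → GBC G O - GBC G (insert u C) ≤
        Real.exp (-((cost c (insert u C) - cost c Y) / (b - cost c Y))) *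
          (GBC G O - GBC G Y)) := by
    intro C U u hu hYC hU huC hinv hB
    have hg : 0 ≤ GBC G (insert u C) - GBC G C :=
      sub_nonneg.2 (GBC_mono G (Finset.subset_insert u C))
    have h1 := gap_mul_cost_le G hc hu hU
    have h2 : cost c (O \ C) ≤ b - cost c Y := by
      have h3 : cost c (O \ C) ≤ cost c (O \ Y) :=
        cost_mono hc (Finset.sdiff_subset_sdiff subset_rfl hYC)
      have h4 : cost c (O \ Y) + cost c Y = cost c O := Finset.sum_sdiff hYO
      linarith
    have h3 := gap_decay_step hB hgap hg
      (h1.trans (mul_le_mul_of_nonneg_right h2 hg)) (hinv hB)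
    rw [cost_insert c huC, add_sub_assoc]
    linarith
  induction h with
  | done C =>
    have hOC : O ⊆ C := by simpa [Finset.sdiff_eq_empty_iff_subset] using hU
    have := GBC_mono G hOC
    have : 0 ≤ Real.exp (-1) * (GBC G O - GBC G Y) := by positivity
    linarith
  | @take C U C' u hu hbu _ ih =>
    have huC : u ∉ C := Finset.disjoint_left.1 hdisj hu.1
    refine ih (hYC.trans (Finset.subset_insert _ _)) ?_ ?_ hbu (step hu hYC hU huC hinv)
    · intro v hv
      simp only [Finset.mem_sdiff, Finset.mem_insert, not_or] at hv
      exact Finset.mem_erase.2 ⟨hv.2.1, hU (Finset.mem_sdiff.2 ⟨hv.1, hv.2.2⟩)⟩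
    · rw [Finset.disjoint_insert_right]
      exact ⟨Finset.notMem_erase _ _, hdisj.mono_left (Finset.erase_subset _ _)⟩
  | @skip C U C' u hu hbu hrest ih =>
    have huC : u ∉ C := Finset.disjoint_left.1 hdisj hu.1
    -- The analysis stops at the first skipped node of `O`. The set `insert u C` is over budget, so
    -- its exponent is below `-1`; dropping `u` again costs at most `δ`, and later iterations only
    -- enlarge `C`.
    by_cases huO : u ∈ O
    · have huY : u ∉ Y := fun h => huC (hYC h)
      have hcost := cost_insert c huC
      have hYu : cost c Y + c u ≤ b := by
        have := cost_mono hc (Finset.insert_subset huO hYO)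
        rw [cost_insert c huY] at this
        linarith
      have hCY := cost_mono hc hYC
      -- A node of cost zero is never skipped, so `c u > 0`, and `Y` together with `u` fits into the
      -- budget.
      have hB : 0 < b - cost c Y := by
        rcases (hc u).eq_or_lt with h0 | h0
        · rw [← h0, zero_add] at hcost
          exact absurd (hcost ▸ hb) hbu
        · linarith
      have h1 := step hu hYC hU huC hinv hB
      have h2 : Real.exp (-((cost c (insert u C) - cost c Y) / (b - cost c Y))) ≤
          Real.exp (-1) := by
        refine Real.exp_le_exp.2 (neg_le_neg ((one_le_div hB).2 ?_))
        linarith [not_le.1 hbu]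
      have h3 := mul_le_mul_of_nonneg_right h2 hgap
      have h4 := hgain C hYC u (Finset.mem_sdiff.2 ⟨huO, huY⟩)
      have h5 := GBC_mono G hrest.subset
      linarith
    · refine ih hYC ?_ (hdisj.mono_left (Finset.erase_subset _ _)) hb hinv
      intro v hv
      refine Finset.mem_erase.2 ⟨?_, hU hv⟩
      rintro rfl
      exact huO (Finset.mem_sdiff.1 hv).1

/-- A set with at least three nodes has a three-element subset over which every further node gains
at most one third of its centrality. -/
theorem exists_seed (G : SimpleGraph V) {O : Finset V} (hO : 3 ≤ O.card) :
    ∃ Y ⊆ O, Y.card = 3 ∧ ∀ D, Y ⊆ D → ∀ v ∈ O \ Y,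
      GBC G (insert v D) - GBC G D ≤ GBC G Y / 3 := by
  have next : ∀ Y ⊆ O, Y.card < 3 → ∃ a ∈ O \ Y, ∀ v ∈ O \ Y,
      GBC G (insert v Y) ≤ GBC G (insert a Y) := by
    intro Y _ hY
    refine Finset.exists_max_image _ _ ?_
    rw [Finset.sdiff_nonempty]
    exact fun h => absurd (Finset.card_le_card h) (by omega)
  obtain ⟨a, ha, hamax⟩ := next ∅ (Finset.empty_subset _) (by simp)
  have haO := (Finset.mem_sdiff.1 ha).1
  have h1O : insert a ∅ ⊆ O := by simpa using haO
  have h1 : (insert a (∅ : Finset V)).card = 1 := by simp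
  obtain ⟨b, hb, hbmax⟩ := next _ h1O (by omega)
  obtain ⟨hbO, hba⟩ := Finset.mem_sdiff.1 hb
  have h2O := Finset.insert_subset hbO h1O
  have h2 := Finset.card_insert_of_notMem hba
  obtain ⟨d, hd, hdmax⟩ := next _ h2O (by omega)
  obtain ⟨hdO, hdb⟩ := Finset.mem_sdiff.1 hd
  have h3 := Finset.card_insert_of_notMem hdb
  refine ⟨_, Finset.insert_subset hdO h2O, by omega, fun D hD v hv => ?_⟩
  obtain ⟨hvO, hv3⟩ := Finset.mem_sdiff.1 hv
  have hv2 : v ∉ insert b (insert a (∅ : Finset V)) := fun h => hv3 (Finset.mem_insert_of_mem h)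
  have hv1 : v ∉ insert a (∅ : Finset V) := fun h => hv2 (Finset.mem_insert_of_mem h)
  have g0 := hamax v (by simpa using hvO)
  have g1 := hbmax v (Finset.mem_sdiff.2 ⟨hvO, hv1⟩)
  have g2 := hdmax v (Finset.mem_sdiff.2 ⟨hvO, hv2⟩)
  have s2 := (Finset.subset_insert d _).trans hD
  have s1 := (Finset.subset_insert b _).trans s2
  have k2 := GBC_insert_sub_le G s2 v
  have k1 := GBC_insert_sub_le G s1 v
  have k0 := GBC_insert_sub_le G (Finset.empty_subset D) v
  have := GBC_nonneg G ∅
  linarith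

theorem foldl_best_mem (G : SimpleGraph V) (run : Finset V → Finset V) (l : List (Finset V))
    (H : Finset V) :
    let R := l.foldl (fun H C => if GBC G (run C) > GBC G H then run C else H) H
    (R = H ∨ ∃ C ∈ l, R = run C) ∧ GBC G H ≤ GBC G R ∧ ∀ C ∈ l, GBC G (run C) ≤ GBC G R := by
  induction l generalizing H with
  | nil => simp
  | cons C l ih =>
    simp only [List.foldl_cons]
    obtain ⟨h1, h2, h3⟩ := ih (if GBC G (run C) > GBC G H then run C else H)
    refine ⟨?_, ?_, ?_⟩
    · rcases h1 with h1 | ⟨D, hD, h1⟩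
      · split_ifs at h1 ⊢
        · exact Or.inr ⟨C, by simp, h1⟩
        · exact Or.inl h1
      · exact Or.inr ⟨D, by simp [hD], h1⟩
    · refine le_trans ?_ h2
      split_ifs with h
      · exact h.le
      · exact le_rfl
    · intro D hD
      rcases List.mem_cons.1 hD with rfl | hD
      · refine le_trans ?_ h2
        split_ifs with h
        · exact le_rfl
        · exact not_lt.1 h
      · exact h3 D hD

theorem ModifiedGreedy.eq_empty_or_run {G : SimpleGraph V} {c : V → ℝ} {b : ℝ} {H : Finset V}
    (h : ModifiedGreedy G c b H) : H = ∅ ∨ ∃ C, C.card ≤ 3 ∧ cost c C ≤ b ∧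
      AugmentLoop G c b C (Finset.univ \ C) H := by
  obtain ⟨order, run, -, hmem, hrun, rfl⟩ := h
  rcases (foldl_best_mem G run order ∅).1 with h | ⟨C, hC, h⟩
  · exact Or.inl h
  · refine Or.inr ⟨C, ((hmem C).1 hC).1, ((hmem C).1 hC).2, ?_⟩
    rw [h]
    exact hrun C hC

theorem ModifiedGreedy.exists_run_le {G : SimpleGraph V} {c : V → ℝ} {b : ℝ} {H : Finset V}
    (h : ModifiedGreedy G c b H) {C : Finset V} (hC : C.card ≤ 3) (hb : cost c C ≤ b) :
    ∃ C', AugmentLoop G c b C (Finset.univ \ C) C' ∧ GBC G C' ≤ GBC G H := by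
  obtain ⟨order, run, -, hmem, hrun, rfl⟩ := h
  have hC' := (hmem C).2 ⟨hC, hb⟩
  exact ⟨run C, hrun C hC', (foldl_best_mem G run order ∅).2.2 C hC'⟩

theorem modifiedGreedyHasFactor : ModifiedGreedyHasFactor (1 - 1 / Real.exp 1) := by
  intro V _ _ G c b _ hc hb H hH
  constructor
  · rcases hH.eq_empty_or_run with rfl | ⟨C, -, hC, hrun⟩
    · simpa [cost] using hb
    · exact hrun.cost_le hC
  rintro O ⟨hOb, -⟩
  rw [one_div, ← Real.exp_neg]
  have he0 := Real.exp_pos (-1)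
  have hO0 := GBC_nonneg G O
  -- A small optimum is itself one of the seeds.
  rcases le_or_gt O.card 3 with h3 | h3
  · obtain ⟨C', hrun, hle⟩ := hH.exists_run_le h3 hOb
    have := GBC_mono G hrun.subset
    have := mul_nonneg he0.le hO0
    linarith
  · obtain ⟨Y, hYO, hY3, hgain⟩ := exists_seed G h3.le
    have hYb := (cost_mono hc hYO).trans hOb
    obtain ⟨C', hrun, hle⟩ := hH.exists_run_le hY3.le hYb
    have hY0 := GBC_nonneg G Y
    have key := hrun.le_GBC hc (by positivity) hOb hYO hgain subset_rfl
      (Finset.sdiff_subset_sdiff (Finset.subset_univ O) subset_rfl) Finset.sdiff_disjoint hYb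
      (fun _ => by simp)
    have he : 1 / 3 ≤ Real.exp (-1) := by
      rw [Real.exp_neg, ← one_div]
      exact one_div_le_one_div_of_le (Real.exp_pos 1) Real.exp_one_lt_three.le
    have := mul_le_mul_of_nonneg_right he hY0
    linarith

end ModifiedGreedyFactor

/-! ### The factor of the greedy algorithm for unit costs -/

section UnitGreedyFactor

theorem UnitGreedy.card_eq {G : SimpleGraph V} {k : ℕ} {H : Finset V} (h : UnitGreedy G k H) :
    H.card = k := by
  induction h with
  | start => rfl
  | step _ hv _ ih => rw [Finset.card_insert_of_notMem hv, ih]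

/-- Each step closes at least the share `1 / n` of the gap. The bound `n` is kept apart from the
number of steps so that it stays fixed in the induction. -/
theorem UnitGreedy.gap_le {G : SimpleGraph V} {k : ℕ} {H O : Finset V} (h : UnitGreedy G k H)
    {n : ℕ} (hn : 0 < n) (hO : O.card ≤ n) :
    GBC G O - GBC G H ≤ Real.exp (-(k / n)) * GBC G O := by
  have hn' : (0 : ℝ) < n := Nat.cast_pos.2 hn
  induction h with
  | start => simpa using GBC_nonneg G ∅
  | @step k C v _ hv hmax ih =>
    have hg : 0 ≤ GBC G (insert v C) - GBC G C :=
      sub_nonneg.2 (GBC_mono G (Finset.subset_insert v C))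
    have h1 : GBC G O - GBC G C ≤ n * (GBC G (insert v C) - GBC G C) := by
      refine (GBC_sub_le_sum_gain G C O).trans ?_
      refine (Finset.sum_le_card_nsmul _ _ (GBC G (insert v C) - GBC G C) fun w hw =>
        sub_le_sub_right (hmax w (Finset.mem_sdiff.1 hw).2) _).trans ?_
      rw [nsmul_eq_mul]
      refine mul_le_mul_of_nonneg_right (Nat.cast_le.2 ?_) hg
      exact (Finset.card_le_card Finset.sdiff_subset).trans hO
    have h2 := gap_decay_step hn' (GBC_nonneg G O) hg (by rwa [one_mul]) ih
    push_cast
    rw [add_comm (k : ℝ)]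
    linarith

theorem unitGreedyHasFactor : UnitGreedyHasFactor (1 - 1 / Real.exp 1) := by
  intro V _ _ G k _ _ H hH
  refine ⟨by rw [cost_one, hH.card_eq], ?_⟩
  rintro O ⟨hOb, -⟩
  rw [cost_one, Nat.cast_le] at hOb
  rw [one_div, ← Real.exp_neg]
  rcases Nat.eq_zero_or_pos k with rfl | hk
  · obtain rfl := Finset.card_eq_zero.1 (Nat.le_zero.1 hOb)
    have h1 := GBC_mono G (Finset.empty_subset H)
    have h2 := mul_nonneg (Real.exp_pos (-1)).le (GBC_nonneg G ∅)
    linarith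
  · have := hH.gap_le hk hOb
    rw [div_self (Nat.cast_pos.2 hk).ne'] at this
    linarith

end UnitGreedyFactor

/-! ### Existence of outputs and optima -/

section Existence

theorem exists_augmentLoop (G : SimpleGraph V) (c : V → ℝ) (b : ℝ) (C U : Finset V) :
    ∃ C', AugmentLoop G c b C U C' := by
  induction hn : U.card generalizing C U with
  | zero =>
    obtain rfl := Finset.card_eq_zero.1 hn
    exact ⟨C, .done C⟩
  | succ n ih =>
    obtain ⟨u, hu, hmax⟩ := Finset.exists_max_image U (relGain G c C)
      (Finset.card_pos.1 (by omega))
    have hcard : (U.erase u).card = n := by rw [Finset.card_erase_of_mem hu]; omega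
    by_cases hb : cost c (insert u C) ≤ b
    · obtain ⟨C', h⟩ := ih (insert u C) _ hcard
      exact ⟨C', .take ⟨hu, hmax⟩ hb h⟩
    · obtain ⟨C', h⟩ := ih C _ hcard
      exact ⟨C', .skip ⟨hu, hmax⟩ hb h⟩

theorem exists_modifiedGreedy (G : SimpleGraph V) (c : V → ℝ) (b : ℝ) :
    ∃ H, ModifiedGreedy G c b H := by
  classical
  choose run hrun using fun C => exists_augmentLoop G c b C (Finset.univ \ C)
  exact ⟨_, (Finset.univ.filter fun C : Finset V => C.card ≤ 3 ∧ cost c C ≤ b).toList, run,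
    Finset.nodup_toList _, fun C => by simp, fun C _ => hrun C, rfl⟩

theorem exists_unitGreedy (G : SimpleGraph V) {k : ℕ} (hk : k ≤ Fintype.card V) :
    ∃ H, UnitGreedy G k H := by
  induction k with
  | zero => exact ⟨∅, .start⟩
  | succ k ih =>
    obtain ⟨C, hC⟩ := ih (by omega)
    have hne : (Finset.univ \ C).Nonempty := by
      rw [Finset.sdiff_nonempty]
      intro h
      have := Finset.card_le_card h
      rw [hC.card_eq, Finset.card_univ] at this
      omega
    obtain ⟨v, hv, hmax⟩ := Finset.exists_max_image _ (fun v => GBC G (insert v C)) hne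
    exact ⟨_, .step hC (Finset.mem_sdiff.1 hv).2 fun w hw => hmax w (by simpa using hw)⟩

theorem exists_isOptimal (G : SimpleGraph V) (c : V → ℝ) {b : ℝ} (hb : 0 ≤ b) :
    ∃ O, IsOptimal G c b O := by
  classical
  obtain ⟨O, hO, hmax⟩ := Finset.exists_max_image
    (Finset.univ.filter fun C : Finset V => cost c C ≤ b) (GBC G) ⟨∅, Finset.mem_filter.2 ⟨Finset.mem_univ _, by simpa [cost] using hb⟩⟩
  simp only [Finset.mem_filter, Finset.mem_univ, true_and] at hO hmax
  exact ⟨O, hO, hmax⟩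

end Existence

end MBC

namespace MBC

/-! ### Covered fractions, the tight graph and its shortest paths -/

section Fractions

variable {V : Type} [Fintype V] [DecidableEq V]

/-- The fraction of the shortest `s`-`t` paths that meet `C`. -/
noncomputable def coveredFraction (G : SimpleGraph V) (C : Finset V) (p : V × V) : ℝ :=
  (sigmaThrough G C p.1 p.2 : ℝ) / (sigma G p.1 p.2 : ℝ)

theorem coveredFraction_nonneg (G : SimpleGraph V) (C : Finset V) (p : V × V) :
    0 ≤ coveredFraction G C p := by
  unfold coveredFraction; positivity

theorem coveredFraction_le_one (G : SimpleGraph V) (C : Finset V) (p : V × V) :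
    coveredFraction G C p ≤ 1 :=
  div_le_one_of_le₀ (Nat.cast_le.2 (sigmaThrough_le_sigma G C p.1 p.2)) (Nat.cast_nonneg _)

theorem coveredFraction_eq_one {G : SimpleGraph V} (hG : G.Connected) {C : Finset V} {s t : V}
    (h : ∀ p : G.Walk s t, p.length = G.dist s t → ∃ v ∈ C, v ∈ p.support) :
    coveredFraction G C (s, t) = 1 := by
  have h1 : sigmaThrough G C s t = sigma G s t := by
    unfold sigmaThrough sigma
    congr 1
    ext p
    exact ⟨fun hp => hp.1, fun hp => ⟨hp, h p hp⟩⟩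
  have h2 : sigma G s t ≠ 0 := by
    obtain ⟨p, hp⟩ := (hG s t).exists_walk_length_eq_dist
    exact Set.ncard_ne_zero_of_mem (a := p) hp (shortestPaths_finite G s t)
  unfold coveredFraction
  rw [h1]
  exact div_self (Nat.cast_ne_zero.2 h2)

theorem coveredFraction_eq_zero {G : SimpleGraph V} {C : Finset V} {s t : V}
    (h : ∀ p : G.Walk s t, p.length = G.dist s t → ∀ v ∈ C, v ∉ p.support) :
    coveredFraction G C (s, t) = 0 := by
  have h1 : sigmaThrough G C s t = 0 := by
    unfold sigmaThrough
    rw [Set.ncard_eq_zero ((shortestPaths_finite G s t).subset fun p hp => hp.1)]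
    ext p
    simp only [Set.mem_ofPred_eq, Set.mem_empty_iff_false, iff_false, not_and, not_exists]
    exact fun hp v hv => h p hp v hv
  unfold coveredFraction
  rw [h1]
  simp

end Fractions

/-- The nodes of the tight instance: `k` columns, each with `N` sources, and `R` rows, the row `i`
with `t i` targets. -/
inductive Node (k N R : ℕ) (t : Fin R → ℕ) : Type
  | src (a : Fin k) (j : Fin N)
  | col (a : Fin k)
  | row (i : Fin R)
  | tgt (i : Fin R) (l : Fin (t i))

variable {k N R : ℕ} {t : Fin R → ℕ}

namespace Node

/-- The nodes as a sum type. -/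
def equivSum : Node k N R t ≃
    ((Fin k × Fin N) ⊕ (Σ i : Fin R, Fin (t i))) ⊕ (Fin k ⊕ Fin R) where
  toFun
    | src a j => Sum.inl (Sum.inl (a, j))
    | tgt i l => Sum.inl (Sum.inr ⟨i, l⟩)
    | col a => Sum.inr (Sum.inl a)
    | row i => Sum.inr (Sum.inr i)
  invFun
    | Sum.inl (Sum.inl (a, j)) => src a j
    | Sum.inl (Sum.inr ⟨i, l⟩) => tgt i l
    | Sum.inr (Sum.inl a) => col a
    | Sum.inr (Sum.inr i) => row i
  left_inv v := by cases v <;> rfl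
  right_inv v := by rcases v with (⟨a, j⟩ | ⟨i, l⟩) | (a | i) <;> rfl

noncomputable instance : DecidableEq (Node k N R t) := Classical.decEq _

instance : Fintype (Node k N R t) := Fintype.ofEquiv _ equivSum.symm

theorem card_eq : Fintype.card (Node k N R t) = (k * N + ∑ i, t i) + (k + R) := by
  rw [Fintype.card_congr equivSum]
  simp

/-- The adjacency of the tight instance. -/
def Adj : Node k N R t → Node k N R t → Prop
  | src a j, src b l => (a, j) ≠ (b, l)
  | src a _, col b => a = b
  | col b, src a _ => a = b
  | col _, row _ => True
  | row _, col _ => True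
  | row i, tgt j _ => i = j
  | tgt j _, row i => i = j
  | _, _ => False

/-- The distance of a node from the clique of sources. -/
def level : Node k N R t → ℕ
  | src _ _ => 0
  | col _ => 1
  | row _ => 2
  | tgt _ _ => 3

theorem Adj.level_le {v w : Node k N R t} (h : Adj v w) : level w ≤ level v + 1 := by
  cases v <;> cases w <;> simp_all [Adj, level]

end Node

open Node

/-- The tight instance: the sources form a clique, every source is adjacent to its column, every
column to every row, and every row to its targets. -/
def tightGraph (k N R : ℕ) (t : Fin R → ℕ) : SimpleGraph (Node k N R t) where
  Adj := Node.Adj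
  symm := ⟨by
    intro v w h
    cases v <;> cases w <;> simp_all [Node.Adj, eq_comm]⟩
  loopless := ⟨by
    intro v h
    cases v <;> simp_all [Node.Adj]⟩

theorem level_le_add_length {v w : Node k N R t} (p : (tightGraph k N R t).Walk v w) :
    level w ≤ level v + p.length := by
  induction p with
  | nil => simp
  | cons h p ih =>
    have := Node.Adj.level_le h
    rw [SimpleGraph.Walk.length_cons]
    omega

theorem adj_src_col (a : Fin k) (j : Fin N) : (tightGraph k N R t).Adj (src a j) (col a) :=
  rfl (a := a)

theorem adj_col_row (a : Fin k) (i : Fin R) : (tightGraph k N R t).Adj (col a) (row i) :=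
  trivial

theorem adj_row_tgt (i : Fin R) (l : Fin (t i)) : (tightGraph k N R t).Adj (row i) (tgt i l) :=
  rfl (a := i)

theorem tightGraph_connected (hk : 0 < k) (hR : 0 < R) : (tightGraph k N R t).Connected := by
  have hcol : ∀ a, (tightGraph k N R t).Reachable (col a) (row ⟨0, hR⟩) := fun a =>
    (adj_col_row a _).reachable
  have hrow : ∀ i, (tightGraph k N R t).Reachable (row i) (row ⟨0, hR⟩) := fun i =>
    (adj_col_row ⟨0, hk⟩ i).reachable.symm.trans (hcol _)
  have hall : ∀ v, (tightGraph k N R t).Reachable v (row ⟨0, hR⟩) := by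
    rintro (⟨a, j⟩ | a | i | ⟨i, l⟩)
    · exact (adj_src_col a j).reachable.trans (hcol _)
    · exact hcol a
    · exact hrow i
    · exact (adj_row_tgt i l).reachable.symm.trans (hrow _)
  exact { preconnected := fun v w => (hall v).trans (hall w).symm, nonempty := ⟨row ⟨0, hR⟩⟩ }

theorem dist_src_tgt_le (a : Fin k) (j : Fin N) (i : Fin R) (l : Fin (t i)) :
    (tightGraph k N R t).dist (src a j) (tgt i l) ≤ 3 :=
  SimpleGraph.dist_le (.cons (adj_src_col a j) (.cons (adj_col_row a i)
    (.cons (adj_row_tgt i l) .nil)))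

/-- The shortest path from a source to a target leads through its column and its row. -/
theorem mem_support_src_tgt {a : Fin k} {j : Fin N} {i : Fin R} {l : Fin (t i)}
    (p : (tightGraph k N R t).Walk (src a j) (tgt i l))
    (hp : p.length = (tightGraph k N R t).dist (src a j) (tgt i l)) (v : Node k N R t) :
    v ∈ p.support ↔ v = src a j ∨ v = col a ∨ v = row i ∨ v = tgt i l := by
  -- At most three edges must climb from level 0 to level 3, so each edge rises by exactly one
  -- level; adjacency then forces the column of the source and the row of the target.
  replace hp := hp.trans_le (dist_src_tgt_le a j i l)
  cases p with
  | @cons _ v₁ _ h₁ p =>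
  have e₁ := level_le_add_length p
  rw [SimpleGraph.Walk.length_cons] at hp
  replace h₁ : Node.Adj _ _ := h₁
  cases v₁ <;> simp only [Node.Adj, level] at h₁ e₁
  case src => omega
  subst h₁
  cases p with
  | @cons _ v₂ _ h₂ p =>
  have e₂ := level_le_add_length p
  rw [SimpleGraph.Walk.length_cons] at hp
  replace h₂ : Node.Adj _ _ := h₂
  cases v₂ <;> simp only [Node.Adj, level] at h₂ e₂
  case src => omega
  cases p with
  | @cons _ v₃ _ h₃ p =>
  have e₃ := level_le_add_length p
  rw [SimpleGraph.Walk.length_cons] at hp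
  replace h₃ : Node.Adj _ _ := h₃
  cases v₃ <;> simp only [Node.Adj, level] at h₃ e₃
  case col => omega
  subst h₃
  have h0 := SimpleGraph.Walk.eq_of_length_eq_zero (p := p) (by omega)
  cases h0
  cases p with
  | nil => simp
  | cons _ p => rw [SimpleGraph.Walk.length_cons] at hp; omega

theorem mem_support_tgt_src {a : Fin k} {j : Fin N} {i : Fin R} {l : Fin (t i)}
    (p : (tightGraph k N R t).Walk (tgt i l) (src a j))
    (hp : p.length = (tightGraph k N R t).dist (tgt i l) (src a j)) (v : Node k N R t) :
    v ∈ p.support ↔ v = src a j ∨ v = col a ∨ v = row i ∨ v = tgt i l := by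
  rw [← mem_support_src_tgt p.reverse (by
    rw [SimpleGraph.Walk.length_reverse, hp, SimpleGraph.dist_comm])]
  simp

/-- The clique keeps the numerous source-source pairs from being met by any node other than their
ends. -/
theorem mem_support_src_src {a b : Fin k} {j l : Fin N}
    (hne : (src a j : Node k N R t) ≠ src b l)
    (p : (tightGraph k N R t).Walk (src a j) (src b l))
    (hp : p.length = (tightGraph k N R t).dist (src a j) (src b l)) (v : Node k N R t) :
    v ∈ p.support → v = src a j ∨ v = src b l := by
  have hadj : (tightGraph k N R t).Adj (src a j) (src b l) := by
    show (a, j) ≠ (b, l)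
    rintro h
    cases h
    exact hne rfl
  rw [SimpleGraph.dist_eq_one_iff_adj.2 hadj] at hp
  cases p with
  | nil => exact absurd rfl hne
  | cons h p =>
    rw [SimpleGraph.Walk.length_cons] at hp
    cases p with
    | nil => simp
    | cons _ p => rw [SimpleGraph.Walk.length_cons] at hp; omega

end MBC

/-! ### Centrality in the tight graph as a count of source-target pairs -/

namespace MBC

variable {k N R : ℕ} {t : Fin R → ℕ}

open Node Finset

/-- The source-target pairs whose column or row belongs to `C`. -/
noncomputable def coveredPairs (C : Finset (Node k N R t)) :
    Finset ((Fin k × Fin N) × Σ i : Fin R, Fin (t i)) :=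
  univ.filter fun q => col q.1.1 ∈ C ∨ row q.2.1 ∈ C

/-- The pairs of nodes, in either order, that are given by `coveredPairs`. -/
noncomputable def coveredNodePairs (C : Finset (Node k N R t)) :
    Finset (Node k N R t × Node k N R t) :=
  (coveredPairs C).image (fun q => (src q.1.1 q.1.2, tgt q.2.1 q.2.2)) ∪
    (coveredPairs C).image (fun q => (tgt q.2.1 q.2.2, src q.1.1 q.1.2))

theorem card_coveredNodePairs (C : Finset (Node k N R t)) :
    (coveredNodePairs C).card = 2 * (coveredPairs C).card := by
  unfold coveredNodePairs
  rw [card_union_of_disjoint, card_image_of_injective, card_image_of_injective, two_mul]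
  · rintro ⟨⟨a, j⟩, i, l⟩ ⟨⟨a', j'⟩, i', l'⟩ h
    simp only [Prod.mk.injEq, src.injEq, tgt.injEq] at h
    obtain ⟨⟨rfl, h⟩, rfl, rfl⟩ := h
    cases h
    rfl
  · rintro ⟨⟨a, j⟩, i, l⟩ ⟨⟨a', j'⟩, i', l'⟩ h
    simp only [Prod.mk.injEq, src.injEq, tgt.injEq] at h
    obtain ⟨⟨rfl, rfl⟩, rfl, h⟩ := h
    cases h
    rfl
  · rw [Finset.disjoint_left]
    intro p hp hp'
    obtain ⟨q, -, rfl⟩ := mem_image.1 hp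
    obtain ⟨q', -, h⟩ := mem_image.1 hp'
    simp at h

theorem two_mul_card_coveredPairs_le_GBC (hk : 0 < k) (hR : 0 < R) (C : Finset (Node k N R t)) :
    2 * ((coveredPairs C).card : ℝ) ≤ GBC (tightGraph k N R t) C := by
  have hG := tightGraph_connected (N := N) (t := t) hk hR
  have hsub : coveredNodePairs C ⊆ univ.offDiag := by
    intro p hp
    rw [mem_offDiag]
    refine ⟨mem_univ _, mem_univ _, ?_⟩
    rcases mem_union.1 hp with hp | hp <;> obtain ⟨q, -, rfl⟩ := mem_image.1 hp <;> simp
  have hone : ∀ p ∈ coveredNodePairs C, coveredFraction (tightGraph k N R t) C p = 1 := by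
    intro p hp
    rcases mem_union.1 hp with hp | hp <;> obtain ⟨q, hq, rfl⟩ := mem_image.1 hp <;>
      refine coveredFraction_eq_one hG fun w hw => ?_
    · rcases (mem_filter.1 hq).2 with h | h
      · exact ⟨_, h, (mem_support_src_tgt w hw _).2 (by simp)⟩
      · exact ⟨_, h, (mem_support_src_tgt w hw _).2 (by simp)⟩
    · rcases (mem_filter.1 hq).2 with h | h
      · exact ⟨_, h, (mem_support_tgt_src w hw _).2 (by simp)⟩
      · exact ⟨_, h, (mem_support_tgt_src w hw _).2 (by simp)⟩
  calc 2 * ((coveredPairs C).card : ℝ) = ((coveredNodePairs C).card : ℝ) := by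
        rw [card_coveredNodePairs]; push_cast; rfl
    _ = ∑ p ∈ coveredNodePairs C, coveredFraction (tightGraph k N R t) C p := by
        rw [sum_congr rfl hone]; simp
    _ ≤ GBC (tightGraph k N R t) C :=
        sum_le_sum_of_subset_of_nonneg hsub fun p _ _ => coveredFraction_nonneg _ _ _

/-- The columns and rows. -/
def centers : Finset (Node k N R t) :=
  univ.map ⟨fun x : Fin k ⊕ Fin R => equivSum.symm (Sum.inr x), fun x y h => by simpa using h⟩

/-- The targets. -/
def targets : Finset (Node k N R t) :=
  univ.map ⟨fun x : Σ i : Fin R, Fin (t i) => equivSum.symm (Sum.inl (Sum.inr x)),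
    fun x y h => by simpa using h⟩

theorem col_mem_centers (a : Fin k) : (col a : Node k N R t) ∈ centers :=
  mem_map.2 ⟨Sum.inl a, mem_univ _, rfl⟩

theorem row_mem_centers (i : Fin R) : (row i : Node k N R t) ∈ centers :=
  mem_map.2 ⟨Sum.inr i, mem_univ _, rfl⟩

theorem tgt_mem_targets (i : Fin R) (l : Fin (t i)) : (tgt i l : Node k N R t) ∈ targets :=
  mem_map.2 ⟨⟨i, l⟩, mem_univ _, rfl⟩

theorem card_centers : (centers : Finset (Node k N R t)).card = k + R := by
  simp [centers]

theorem card_targets : (targets : Finset (Node k N R t)).card = ∑ i, t i := by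
  simp [targets]

/-- The pairs, outside `coveredNodePairs`, that may be met by `C`. -/
noncomputable def exceptionalPairs (C : Finset (Node k N R t)) :
    Finset (Node k N R t × Node k N R t) :=
  ((C ∪ centers) ×ˢ univ ∪ univ ×ˢ (C ∪ centers)) ∪ targets ×ˢ targets

theorem card_exceptionalPairs_le (C : Finset (Node k N R t)) :
    (exceptionalPairs C).card ≤
      2 * (C.card + (k + R)) * Fintype.card (Node k N R t) + (∑ i, t i) ^ 2 := by
  have h := card_union_le C (centers : Finset (Node k N R t))
  rw [card_centers] at h
  refine (card_union_le _ _).trans (add_le_add ((card_union_le _ _).trans ?_) ?_)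
  · rw [card_product, card_product, card_univ]
    have := Nat.mul_le_mul_right (Fintype.card (Node k N R t)) h
    linarith
  · rw [card_product, card_targets, sq]

theorem coveredFraction_eq_zero_of_notMem {C : Finset (Node k N R t)}
    {p : Node k N R t × Node k N R t} (hne : p.1 ≠ p.2) (h1 : p ∉ coveredNodePairs C)
    (h2 : p ∉ exceptionalPairs C) : coveredFraction (tightGraph k N R t) C p = 0 := by
  obtain ⟨v, w⟩ := p
  simp only [exceptionalPairs, mem_union, mem_product, mem_univ, and_true, true_and, not_or] at h2
  obtain ⟨⟨⟨hvC, hvm⟩, hwC, hwm⟩, hT⟩ := h2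
  cases v with
  | col a => exact absurd (col_mem_centers a) hvm
  | row i => exact absurd (row_mem_centers i) hvm
  | src a j =>
    cases w with
    | col a => exact absurd (col_mem_centers a) hwm
    | row i => exact absurd (row_mem_centers i) hwm
    | src b l =>
      refine coveredFraction_eq_zero fun p hp v hv hvp => ?_
      rcases mem_support_src_src hne p hp v hvp with rfl | rfl
      · exact hvC hv
      · exact hwC hv
    | tgt i l =>
      have hq : ((a, j), ⟨i, l⟩) ∉ coveredPairs C := fun h =>
        h1 (mem_union_left _ (mem_image.2 ⟨_, h, rfl⟩))
      simp only [coveredPairs, mem_filter, mem_univ, true_and, not_or] at hq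
      refine coveredFraction_eq_zero fun p hp v hv hvp => ?_
      rcases (mem_support_src_tgt p hp v).1 hvp with rfl | rfl | rfl | rfl
      · exact hvC hv
      · exact hq.1 hv
      · exact hq.2 hv
      · exact hwC hv
  | tgt i l =>
    cases w with
    | col a => exact absurd (col_mem_centers a) hwm
    | row i => exact absurd (row_mem_centers i) hwm
    | tgt b l => exact absurd ⟨tgt_mem_targets _ _, tgt_mem_targets _ _⟩ hT
    | src a j =>
      have hq : ((a, j), ⟨i, l⟩) ∉ coveredPairs C := fun h =>
        h1 (mem_union_right _ (mem_image.2 ⟨_, h, rfl⟩))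
      simp only [coveredPairs, mem_filter, mem_univ, true_and, not_or] at hq
      refine coveredFraction_eq_zero fun p hp v hv hvp => ?_
      rcases (mem_support_tgt_src p hp v).1 hvp with rfl | rfl | rfl | rfl
      · exact hwC hv
      · exact hq.1 hv
      · exact hq.2 hv
      · exact hvC hv

/-- Each covered or exceptional pair contributes at most 1, all others nothing. For fixed `t`, `k`,
`R` and bounded `C.card` the error is linear in `N`, with a slope that does not involve `t`; scaling
`t` therefore makes it negligible. -/
theorem GBC_le_card_coveredPairs (C : Finset (Node k N R t)) :
    GBC (tightGraph k N R t) C ≤ 2 * ((coveredPairs C).card : ℝ) +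
      ((2 * (C.card + (k + R)) * Fintype.card (Node k N R t) + (∑ i, t i) ^ 2 : ℕ) : ℝ) := by
  have hle : ∀ p ∈ (univ : Finset (Node k N R t)).offDiag,
      coveredFraction (tightGraph k N R t) C p ≤
        if p ∈ coveredNodePairs C ∪ exceptionalPairs C then 1 else 0 := by
    intro p hp
    split_ifs with h
    · exact coveredFraction_le_one _ _ _
    · rw [mem_union, not_or] at h
      exact (coveredFraction_eq_zero_of_notMem (mem_offDiag.1 hp).2.2 h.1 h.2).le
  calc GBC (tightGraph k N R t) C
      ≤ ∑ p ∈ (univ : Finset (Node k N R t)).offDiag,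
          if p ∈ coveredNodePairs C ∪ exceptionalPairs C then (1 : ℝ) else 0 := sum_le_sum hle
    _ ≤ ∑ p, if p ∈ coveredNodePairs C ∪ exceptionalPairs C then (1 : ℝ) else 0 :=
        sum_le_sum_of_subset_of_nonneg (subset_univ _) fun p _ _ => by positivity
    _ = ((coveredNodePairs C ∪ exceptionalPairs C).card : ℝ) := by
        rw [sum_boole, filter_mem_eq_inter, univ_inter]
    _ ≤ ((coveredNodePairs C).card + (exceptionalPairs C).card : ℕ) :=
        Nat.cast_le.2 (card_union_le _ _)
    _ ≤ _ := by
        rw [card_coveredNodePairs]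
        push_cast
        gcongr
        exact_mod_cast card_exceptionalPairs_le C

/-- The number of columns outside `C`. -/
noncomputable def freeCols (C : Finset (Node k N R t)) : ℕ :=
  (univ.filter fun a : Fin k => (col a : Node k N R t) ∉ C).card

/-- The total number of targets of the rows outside `C`. -/
noncomputable def freeTargets (C : Finset (Node k N R t)) : ℕ :=
  ∑ i ∈ univ.filter (fun i : Fin R => (row i : Node k N R t) ∉ C), t i

/-- The uncovered pairs form a product: sources of free columns times targets of free rows. -/
theorem card_coveredPairs_add (C : Finset (Node k N R t)) :
    (coveredPairs C).card + freeCols C * N * freeTargets C = k * N * ∑ i, t i := by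
  have h1 : (univ.filter fun q : (Fin k × Fin N) × Σ i : Fin R, Fin (t i) =>
      ¬ ((col q.1.1 : Node k N R t) ∈ C ∨ (row q.2.1 : Node k N R t) ∈ C)) =
      ((univ.filter fun a : Fin k => (col a : Node k N R t) ∉ C) ×ˢ univ) ×ˢ
        ((univ.filter fun i : Fin R => (row i : Node k N R t) ∉ C).sigma fun _ => univ) := by
    ext ⟨⟨a, j⟩, i, l⟩
    simp
  have h2 : (univ.filter fun q : (Fin k × Fin N) × Σ i : Fin R, Fin (t i) =>
      ¬ ((col q.1.1 : Node k N R t) ∈ C ∨ (row q.2.1 : Node k N R t) ∈ C)).card =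
      freeCols C * N * freeTargets C := by
    rw [h1, card_product, card_product, card_sigma]
    simp [freeCols, freeTargets]
  rw [← h2]
  unfold coveredPairs
  rw [card_filter_add_card_filter_not]
  simp

theorem freeTargets_insert_of_ne_row {C : Finset (Node k N R t)} {v : Node k N R t}
    (hv : ∀ i, v ≠ row i) : freeTargets (insert v C) = freeTargets C := by
  unfold freeTargets
  congr 1
  ext i
  simp [(hv i).symm]

theorem freeTargets_insert_row {C : Finset (Node k N R t)} {i : Fin R}
    (hi : (row i : Node k N R t) ∉ C) :
    freeTargets (insert (row i) C) + t i = freeTargets C := by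
  unfold freeTargets
  rw [← sum_erase_add (univ.filter fun i : Fin R => (row i : Node k N R t) ∉ C) t
    (mem_filter.2 ⟨mem_univ i, hi⟩)]
  congr 2
  ext j
  simp [not_or]

theorem freeCols_insert_row (C : Finset (Node k N R t)) (i : Fin R) :
    freeCols (insert (row i) C) = freeCols C := by
  simp [freeCols]

theorem freeCols_le_insert (C : Finset (Node k N R t)) (v : Node k N R t) :
    freeCols C ≤ freeCols (insert v C) + 1 := by
  unfold freeCols
  cases v with
  | col a =>
    refine le_trans (card_le_card ?_) (card_insert_le a _)
    intro b hb
    simp only [mem_insert, mem_filter, mem_univ, true_and, col.injEq, not_or] at hb ⊢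
    tauto
  | _ => simp

theorem le_freeCols_add_card (C : Finset (Node k N R t)) : k ≤ freeCols C + C.card := by
  induction C using Finset.induction_on with
  | empty => simp [freeCols]
  | insert v C hv ih =>
    rw [card_insert_of_notMem hv]
    have := freeCols_le_insert C v
    omega

theorem card_rows_le (C : Finset (Node k N R t)) (s : Finset (Fin R))
    (hs : ∀ i ∈ s, (row i : Node k N R t) ∈ C) : s.card ≤ C.card :=
  card_le_card_of_injOn _ hs fun i _ j _ h => by simpa using h

end MBC

/-! ### Greedy choices on the tight instance and the resulting ratio -/

namespace MBC

open Node Finset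

/-- Conditions under which greedy choices on the tight instance with `m + 4` columns are rows. -/
structure IsTight (m N R : ℕ) (t : Fin R → ℕ) (τ : ℕ) : Prop where
  rows : R = m + 4 + m
  sum_le : ∀ j : Fin R, (j : ℕ) < m + 4 → ∑ i ∈ univ.filter (fun i => j ≤ i), t i ≤ m * t j
  le : ∀ i, τ ≤ t i
  error_lt : 2 * (m + 4 + (m + 4 + R)) * Fintype.card (Node (m + 4) N R t) + (∑ i, t i) ^ 2 <
    2 * N * τ

variable {m N R τ : ℕ} {t : Fin R → ℕ}

theorem IsTight.GBC_lt (h : IsTight m N R t τ) {C : Finset (Node (m + 4) N R t)}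
    (hC : C.card ≤ m + 4) :
    GBC (tightGraph (m + 4) N R t) C < 2 * ((coveredPairs C).card : ℝ) + ((2 * N * τ : ℕ) : ℝ) := by
  refine (GBC_le_card_coveredPairs C).trans_lt (add_lt_add_right (Nat.cast_lt.2 ?_) _)
  refine lt_of_le_of_lt ?_ h.error_lt
  gcongr

/-- The witness is the first free row. Its index is below `m + 4`, as `C` is too small to contain
all those rows, and every other free row comes later, so `sum_le` applies. -/
theorem IsTight.exists_free_row (h : IsTight m N R t τ) {C : Finset (Node (m + 4) N R t)}
    (hC : C.card < m + 4) :
    ∃ i : Fin R, (row i : Node (m + 4) N R t) ∉ C ∧ freeTargets C ≤ m * t i := by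
  have hex : ∃ i : Fin R, (i : ℕ) < m + 4 ∧ (row i : Node (m + 4) N R t) ∉ C := by
    by_contra! hcon
    have h1 := card_rows_le C (univ.filter fun i : Fin R => (i : ℕ) < m + 4)
      (fun i hi => hcon i (mem_filter.1 hi).2)
    have h2 := h.rows
    rw [Fin.card_filter_val_lt] at h1
    omega
  obtain ⟨i, hi, hiC⟩ := hex
  obtain ⟨j, hj, hmin⟩ := exists_min_image
    (univ.filter fun i : Fin R => (row i : Node (m + 4) N R t) ∉ C) id
    ⟨i, mem_filter.2 ⟨mem_univ _, hiC⟩⟩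
  have hji : j ≤ i := hmin i (mem_filter.2 ⟨mem_univ _, hiC⟩)
  refine ⟨j, (mem_filter.1 hj).2, le_trans ?_ (h.sum_le j (lt_of_le_of_lt hji hi))⟩
  exact sum_le_sum_of_subset fun l hl => mem_filter.2 ⟨mem_univ _, hmin l hl⟩

/-- As long as `m + 1` columns are free, each greedy choice is a row. -/
theorem IsTight.exists_eq_row (h : IsTight m N R t τ) {C : Finset (Node (m + 4) N R t)}
    (hC : C.card < m + 4) (hcols : m + 1 ≤ freeCols C) {v : Node (m + 4) N R t}
    (hmax : ∀ w, w ∉ C → GBC (tightGraph (m + 4) N R t) (insert w C) ≤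
      GBC (tightGraph (m + 4) N R t) (insert v C)) : ∃ i, v = row i := by
  by_contra! hv
  obtain ⟨i, hi, hle⟩ := h.exists_free_row hC
  have hmi := hmax _ hi
  have hlow := two_mul_card_coveredPairs_le_GBC (by omega) i.pos (insert (row i) C)
  have hupp := h.GBC_lt ((card_insert_le v C).trans hC)
  have hlt : 2 * (coveredPairs (insert (row i) C)).card <
      2 * (coveredPairs (insert v C)).card + 2 * N * τ := by
    exact_mod_cast (hlow.trans hmi).trans_lt hupp
  have h1 := card_coveredPairs_add (insert (row i) C)
  have h2 := card_coveredPairs_add (insert v C)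
  have h3 := freeTargets_insert_row hi
  have h4 := freeCols_le_insert C v
  rw [freeCols_insert_row] at h1
  rw [freeTargets_insert_of_ne_row hv] at h2
  have hτ := Nat.mul_le_mul_left N (h.le i)
  generalize (coveredPairs (insert (row i) C)).card = x at *
  generalize (coveredPairs (insert v C)).card = y at *
  generalize freeTargets (insert (row i) C) = ρ' at *
  generalize freeTargets C = ρ at *
  generalize freeCols (insert v C) = u' at *
  -- With `u + 1` free columns the row gains `(u + 1) * N * t i` pairs, whereas `v` gains at most `N
  -- * ρ ≤ u * N * t i` because `m ≤ u`. The surplus is at least `N * τ`, which contradicts `hlt`.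
  obtain ⟨u, hu⟩ := Nat.exists_eq_add_of_le' (show 1 ≤ freeCols C by omega)
  rw [hu] at h1 h4 hcols
  have h5 : u * N * ρ ≤ u' * N * ρ := by gcongr; omega
  have h6 : N * ρ ≤ N * (u * t i) :=
    Nat.mul_le_mul_left N (hle.trans (Nat.mul_le_mul_right _ (by omega)))
  have h7 : u * N * ρ = u * N * ρ' + N * (u * t i) := by rw [← h3]; ring
  have h8 : (u + 1) * N * ρ' = u * N * ρ' + N * ρ' := by ring
  have h9 : N * ρ = N * ρ' + N * t i := by rw [← h3]; ring
  have h10 : 2 * N * τ = 2 * (N * τ) := by ring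
  omega

theorem IsTight.freeCols_of_unitGreedy (h : IsTight m N R t τ) {n : ℕ} (hn : n ≤ m + 4)
    {C : Finset (Node (m + 4) N R t)} (hC : UnitGreedy (tightGraph (m + 4) N R t) n C) :
    m + 1 ≤ freeCols C := by
  induction hC with
  | start => simp [freeCols]
  | @step n C v hC hv hmax ih =>
    have hcols := ih (by omega)
    obtain ⟨i, rfl⟩ := h.exists_eq_row (by rw [hC.card_eq]; omega) hcols hmax
    rwa [freeCols_insert_row]

/-- With unit costs no node is skipped before the budget is exhausted, so until then `U` is the
whole complement of `C` and a node of best relative gain is a greedy choice among all nodes outside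
`C`. -/
theorem IsTight.freeCols_of_augmentLoop (h : IsTight m N R t τ)
    {C U C' : Finset (Node (m + 4) N R t)}
    (hrun : AugmentLoop (tightGraph (m + 4) N R t) (fun _ => 1) ((m + 4 : ℕ) : ℝ) C U C')
    (hcols : m + 1 ≤ freeCols C) (hdisj : Disjoint U C)
    (hU : C.card < m + 4 → U = univ \ C) : m + 1 ≤ freeCols C' := by
  induction hrun with
  | done C => exact hcols
  | @take C U C' u hu hb _ ih =>
    rw [cost_one, Nat.cast_le] at hb
    have huC : u ∉ C := Finset.disjoint_left.1 hdisj hu.1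
    have hC : C.card < m + 4 := by rw [card_insert_of_notMem huC] at hb; omega
    have hUC := hU hC
    obtain ⟨i, rfl⟩ := h.exists_eq_row (v := u) hC hcols fun w hw => by
      have hle := hu.2 w (by rw [hUC]; simpa using hw)
      unfold relGain at hle
      rw [ENNReal.ofReal_one, div_one, div_one, ENNReal.ofReal_le_ofReal_iff
        (sub_nonneg.2 (GBC_mono _ (subset_insert u C)))] at hle
      linarith
    refine ih (by rwa [freeCols_insert_row]) ?_ fun _ => ?_
    · rw [disjoint_insert_right]
      exact ⟨notMem_erase _ _, hdisj.mono_left (erase_subset _ _)⟩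
    · rw [hUC]
      ext w
      simp [not_or]
  | @skip C U C' u hu hb _ ih =>
    rw [cost_one, Nat.cast_le] at hb
    refine ih hcols (hdisj.mono_left (erase_subset _ _)) fun hC => absurd ?_ hb
    exact (card_insert_le u C).trans hC

theorem IsTight.freeCols_of_modifiedGreedy (h : IsTight m N R t τ)
    {H : Finset (Node (m + 4) N R t)}
    (hH : ModifiedGreedy (tightGraph (m + 4) N R t) (fun _ => 1) ((m + 4 : ℕ) : ℝ) H) :
    H.card ≤ m + 4 ∧ m + 1 ≤ freeCols H := by
  rcases hH.eq_empty_or_run with rfl | ⟨C, hC, hb, hrun⟩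
  · simp [freeCols]
  · refine ⟨by simpa only [cost_one, Nat.cast_le] using hrun.cost_le hb, ?_⟩
    refine h.freeCols_of_augmentLoop hrun ?_ sdiff_disjoint fun _ => rfl
    have := le_freeCols_add_card C
    omega

theorem IsTight.le_freeTargets (h : IsTight m N R t τ) {C : Finset (Node (m + 4) N R t)}
    (hC : C.card ≤ m + 4) : m * τ ≤ freeTargets C := by
  have h1 := card_rows_le C (univ.filter fun i : Fin R => (row i : Node (m + 4) N R t) ∈ C)
    fun i hi => (mem_filter.1 hi).2
  have h2 := card_filter_add_card_filter_not (s := (univ : Finset (Fin R)))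
    fun i => (row i : Node (m + 4) N R t) ∈ C
  have h3 := h.rows
  rw [card_univ, Fintype.card_fin] at h2
  calc m * τ ≤ (univ.filter fun i : Fin R => (row i : Node (m + 4) N R t) ∉ C).card * τ :=
        Nat.mul_le_mul_right _ (by omega)
    _ ≤ freeTargets C := by
        rw [← smul_eq_mul]
        exact card_nsmul_le_sum _ _ _ fun i _ => h.le i

/-- The centrality of a set that leaves `m + 1` columns free. -/
theorem IsTight.GBC_le (h : IsTight m N R t τ) {C : Finset (Node (m + 4) N R t)}
    (hC : C.card ≤ m + 4) (hcols : m + 1 ≤ freeCols C) :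
    GBC (tightGraph (m + 4) N R t) C + 2 * ((m + 1) * m - 1) * (N * τ) ≤
      2 * ((m + 4) * N * ∑ i, (t i : ℝ)) := by
  -- The error term `2 * N * τ` accounts for the `- 1` in the statement.
  have h1 := h.GBC_lt hC
  have h2 := card_coveredPairs_add C
  have h3 : (m + 1) * N * (m * τ) ≤ freeCols C * N * freeTargets C :=
    Nat.mul_le_mul (Nat.mul_le_mul_right _ hcols) (h.le_freeTargets hC)
  have h4 : (coveredPairs C).card + (m + 1) * N * (m * τ) ≤ (m + 4) * N * ∑ i, t i := by omega
  have h5 : ((coveredPairs C).card : ℝ) + (m + 1) * N * (m * τ) ≤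
      (m + 4) * N * ∑ i, (t i : ℝ) := by exact_mod_cast h4
  push_cast at h1
  linarith

/-- The set of all columns meets all source-target pairs. -/
theorem IsTight.le_GBC_optimal (h : IsTight m N R t τ) {O : Finset (Node (m + 4) N R t)}
    (hO : IsOptimal (tightGraph (m + 4) N R t) (fun _ => 1) ((m + 4 : ℕ) : ℝ) O) :
    2 * ((m + 4) * N * ∑ i, (t i : ℝ)) ≤ GBC (tightGraph (m + 4) N R t) O := by
  have h1 : (univ.image (col : Fin (m + 4) → Node (m + 4) N R t)).card ≤ m + 4 :=
    card_image_le.trans (by simp)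
  refine le_trans ?_ (hO.2 (univ.image col) (by rw [cost_one]; exact_mod_cast h1))
  refine le_trans (le_of_eq ?_)
    (two_mul_card_coveredPairs_le_GBC (by omega) (by rw [h.rows]; omega) _)
  have h2 := card_coveredPairs_add (univ.image (col : Fin (m + 4) → Node (m + 4) N R t))
  have h3 : freeCols (univ.image (col : Fin (m + 4) → Node (m + 4) N R t)) = 0 := by
    simp [freeCols]
  rw [h3, zero_mul, zero_mul, add_zero] at h2
  rw [h2]
  push_cast
  rfl

/-- The ratio of every set that leaves `m + 1` columns free. -/
theorem IsTight.ratio_le (h : IsTight m N R t τ) (hm : 0 < m)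
    {C O : Finset (Node (m + 4) N R t)} (hC : C.card ≤ m + 4) (hcols : m + 1 ≤ freeCols C)
    (hO : IsOptimal (tightGraph (m + 4) N R t) (fun _ => 1) ((m + 4 : ℕ) : ℝ) O) :
    0 < GBC (tightGraph (m + 4) N R t) O ∧
    GBC (tightGraph (m + 4) N R t) C / GBC (tightGraph (m + 4) N R t) O ≤
      1 - ((m + 1) * m - 1) / ((m + 4) * m) * (τ / t ⟨0, by rw [h.rows]; omega⟩) := by
  have hR : 0 < R := by rw [h.rows]; omega
  have hNτ : 0 < 2 * N * τ := (Nat.zero_le _).trans_lt h.error_lt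
  have hN : 0 < N := Nat.pos_of_ne_zero fun h0 => by simp [h0] at hNτ
  have hτ : 0 < τ := Nat.pos_of_ne_zero fun h0 => by simp [h0] at hNτ
  have hT : ∑ i, t i ≤ m * t ⟨0, hR⟩ := by
    have := h.sum_le ⟨0, hR⟩ (by simp)
    rwa [filter_true_of_mem fun i _ => Fin.mk_le_of_le_val (Nat.zero_le _)] at this
  have hT' : ∑ i, (t i : ℝ) ≤ m * t ⟨0, hR⟩ := by exact_mod_cast hT
  have ht0 : 0 < t ⟨0, hR⟩ := hτ.trans_le (h.le _)
  have hTpos : 0 < ∑ i, (t i : ℝ) := by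
    have : 0 < ∑ i, t i := ht0.trans_le (single_le_sum (f := t) (fun _ _ => Nat.zero_le _)
      (mem_univ _))
    exact_mod_cast this
  have h1 := h.GBC_le hC hcols
  have h2 := h.le_GBC_optimal hO
  have hm' : (1 : ℝ) ≤ m := by exact_mod_cast hm
  have hN' : (0 : ℝ) < N := by exact_mod_cast hN
  have hτ' : (0 : ℝ) < τ := by exact_mod_cast hτ
  have ht0' : (0 : ℝ) < t ⟨0, hR⟩ := by exact_mod_cast ht0
  have hK : (0 : ℝ) < (m + 4) * N * ∑ i, (t i : ℝ) := by positivity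
  have hOpos : 0 < GBC (tightGraph (m + 4) N R t) O := by linarith
  refine ⟨hOpos, ?_⟩
  have hcoef : (0 : ℝ) ≤ (m + 1) * m - 1 := by nlinarith
  calc GBC (tightGraph (m + 4) N R t) C / GBC (tightGraph (m + 4) N R t) O
      ≤ GBC (tightGraph (m + 4) N R t) C / (2 * ((m + 4) * N * ∑ i, (t i : ℝ))) := by
        have := GBC_nonneg (tightGraph (m + 4) N R t) C
        gcongr
    _ ≤ (2 * ((m + 4) * N * ∑ i, (t i : ℝ)) - 2 * ((m + 1) * m - 1) * (N * τ)) /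
          (2 * ((m + 4) * N * ∑ i, (t i : ℝ))) := by
        gcongr
        linarith
    _ = 1 - ((m + 1) * m - 1) * τ / ((m + 4) * ∑ i, (t i : ℝ)) := by
        field_simp
    _ ≤ 1 - ((m + 1) * m - 1) * τ / ((m + 4) * (m * t ⟨0, hR⟩)) := by
        gcongr
    _ = _ := by
        rw [div_mul_div_comm, mul_assoc (m + 4 : ℝ)]

end MBC

/-! ### Choice of the row weights and passage to the limit -/

namespace MBC

open Node Finset Filter Topology

/-- Row weights: geometric with ratio `(m - 1) / m` up to row `n`, and constant from there on. -/
def rowWeight (q n i : ℕ) : ℕ := q ^ min i n * (q + 1) ^ (n - min i n)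

/-- Downward induction: from row `n` on there are `q + 1` equal terms, and below it `q + 1` copies
of the weight of row `j + 1` equal `q` copies of the weight of row `j`. -/
theorem sum_rowWeight (q n : ℕ) {j : ℕ} (hj : j ≤ n) :
    ∑ i ∈ Ico j (n + (q + 1)), rowWeight q n i = (q + 1) * rowWeight q n j := by
  induction hj using Nat.decreasingInduction with
  | self =>
    rw [sum_congr rfl (g := fun _ => rowWeight q n n) fun i hi => ?_]
    · simp
    · simp [rowWeight, min_eq_right (mem_Ico.1 hi).1]
  | of_succ j hj ih =>
    rw [sum_eq_sum_Ico_succ_bot (by omega), ih]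
    unfold rowWeight
    obtain ⟨d, rfl⟩ := Nat.exists_eq_add_of_lt hj
    rw [min_eq_left (by omega), min_eq_left (by omega), show j + d + 1 - j = d + 1 by omega,
      show j + d + 1 - (j + 1) = d by omega]
    ring

theorem pow_le_rowWeight (q n i : ℕ) : q ^ n ≤ rowWeight q n i := by
  unfold rowWeight
  calc q ^ n = q ^ min i n * q ^ (n - min i n) := by rw [← pow_add]; congr 1; omega
    _ ≤ _ := by gcongr; omega

theorem exists_isTight {q : ℕ} (hq : 0 < q) :
    ∃ (N R τ : ℕ) (t : Fin R → ℕ) (h : IsTight (q + 1) N R t τ),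
      (τ : ℝ) / t ⟨0, by rw [h.rows]; omega⟩ = (q / (q + 1)) ^ (q + 5) := by
  set k := q + 1 + 4 with hk
  set R := k + (q + 1) with hR
  -- `N * B` bounds the error: there are at most `(k + 1) * N` nodes, and the last summand pays for
  -- the target-target pairs, since `T ^ 2 ≤ N`.
  set B := 2 * (k + (k + R)) * (k + 1) + 1 with hB
  set t : Fin R → ℕ := fun i => B * rowWeight q k i with ht
  set T := ∑ i, t i with hT
  set N := T ^ 2 + T + (k + R) with hN
  have hNpos : 0 < N := by omega
  have h : IsTight (q + 1) N R t (B * q ^ k) := by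
    refine ⟨rfl, fun j hj => ?_, fun i => Nat.mul_le_mul_left _ (pow_le_rowWeight q k i), ?_⟩
    · have h1 := sum_rowWeight q k hj.le
      rw [ht, ← mul_sum, mul_left_comm, ← h1]
      refine Nat.mul_le_mul_left _ (le_of_eq ?_)
      refine sum_bij (fun i _ => (i : ℕ)) (fun i hi => ?_) (fun i _ i' _ h => Fin.ext h)
        (fun i hi => ?_) fun _ _ => rfl
      · exact mem_Ico.2 ⟨(mem_filter.1 hi).2, i.2⟩
      · exact ⟨⟨i, (mem_Ico.1 hi).2⟩, mem_filter.2 ⟨mem_univ _, (mem_Ico.1 hi).1⟩, rfl⟩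
    · rw [Node.card_eq]
      have h1 : 1 ≤ q ^ k := Nat.one_le_pow _ _ hq
      have h2 : k * N + T + (k + R) ≤ (k + 1) * N := by
        have h3 : T + (k + R) ≤ N := by omega
        linarith [add_one_mul k N]
      have h3 : T ^ 2 ≤ N := by omega
      calc 2 * (k + (k + R)) * (k * N + T + (k + R)) + T ^ 2
          ≤ 2 * (k + (k + R)) * ((k + 1) * N) + N := by gcongr
        _ = N * B := by rw [hB]; ring
        _ < 2 * N * B := by
            have : 0 < N * B := Nat.mul_pos hNpos (by omega)
            rw [mul_assoc]; omega
        _ = 2 * N * (B * 1) := by rw [mul_one]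
        _ ≤ 2 * N * (B * q ^ k) := by gcongr
  refine ⟨N, R, B * q ^ k, t, h, ?_⟩
  have hB' : (B : ℝ) ≠ 0 := by rw [hB]; positivity
  simp only [ht, rowWeight]
  push_cast
  simp only [Nat.zero_min, pow_zero, one_mul, Nat.sub_zero]
  rw [mul_div_mul_left _ _ hB', ← div_pow]

theorem tendsto_ratio :
    Tendsto (fun q : ℕ => 1 - (((q + 1 : ℕ) + 1) * (q + 1 : ℕ) - 1 : ℝ) /
      (((q + 1 : ℕ) + 4) * (q + 1 : ℕ)) * ((q : ℝ) / (q + 1)) ^ (q + 5)) atTop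
      (𝓝 (1 - 1 / Real.exp 1)) := by
  have hinv : Tendsto (fun q : ℕ => (1 : ℝ) / ((q : ℝ) + 1)) atTop (𝓝 0) :=
    tendsto_one_div_add_atTop_nhds_zero_nat
  have h1 : Tendsto (fun q : ℕ => (((q + 1 : ℕ) + 1) * (q + 1 : ℕ) - 1 : ℝ) /
      (((q + 1 : ℕ) + 4) * (q + 1 : ℕ))) atTop (𝓝 1) := by
    have h := ((tendsto_const_nhds (x := (1 : ℝ))).add hinv |>.sub (hinv.mul hinv)).div
      ((tendsto_const_nhds (x := (1 : ℝ))).add (hinv.const_mul 4)) (by norm_num)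
    norm_num at h
    refine h.congr fun q => ?_
    have : (q : ℝ) + 1 ≠ 0 := by positivity
    have : (q : ℝ) + 1 + 4 ≠ 0 := by positivity
    simp only [Pi.div_apply]
    push_cast
    field_simp
  have h2 : Tendsto (fun q : ℕ => ((q : ℝ) / (q + 1)) ^ (q + 5)) atTop
      (𝓝 (1 / Real.exp 1)) := by
    -- The power splits into the exponent `q + 1`, which gives `1/e`, and the exponent 4, which
    -- gives 1.
    have h := (Real.tendsto_one_add_div_pow_exp (-1)).comp (tendsto_add_atTop_nat 1)
    have h4 := ((tendsto_const_nhds (x := (1 : ℝ))).sub hinv).pow 4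
    have h5 := h.mul h4
    rw [Real.exp_neg, sub_zero, one_pow, mul_one, ← one_div] at h5
    refine h5.congr fun q => ?_
    have : (q : ℝ) + 1 ≠ 0 := by positivity
    simp only [Function.comp_apply]
    rw [show (1 : ℝ) + -1 / ((q + 1 : ℕ) : ℝ) = q / (q + 1) by push_cast; field_simp; ring,
      show (1 : ℝ) - 1 / ((q : ℝ) + 1) = q / (q + 1) by field_simp; ring, ← pow_add]
  simpa using (tendsto_const_nhds (x := (1 : ℝ))).sub (h1.mul h2)

/-- Unit-cost instances on which all outputs of both algorithms have ratio close to `1 - 1/e`. -/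
theorem exists_tight_instance (ε : ℝ) (hε : 0 < ε) :
    ∃ (V : Type) (_ : Fintype V) (_ : DecidableEq V) (G : SimpleGraph V) (k : ℕ) (O : Finset V),
      G.Connected ∧ k ≤ Fintype.card V ∧
      IsOptimal G (fun _ => 1) k O ∧ 0 < GBC G O ∧
      (∃ H, ModifiedGreedy G (fun _ => 1) k H) ∧
      (∃ H, UnitGreedy G k H) ∧
      (∀ H, ModifiedGreedy G (fun _ => 1) k H →
        |GBC G H / GBC G O - (1 - 1 / Real.exp 1)| < ε) ∧
      (∀ H, UnitGreedy G k H →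
        |GBC G H / GBC G O - (1 - 1 / Real.exp 1)| < ε) := by
  obtain ⟨q, hlt, hq⟩ := ((tendsto_ratio.eventually (gt_mem_nhds
    (show 1 - 1 / Real.exp 1 < 1 - 1 / Real.exp 1 + ε by linarith))).and
    (eventually_gt_atTop 0)).exists
  obtain ⟨N, R, τ, t, h, hratio⟩ := exists_isTight hq
  obtain ⟨O, hO⟩ := exists_isOptimal (tightGraph (q + 1 + 4) N R t) (fun _ => 1)
    (b := ((q + 1 + 4 : ℕ) : ℝ)) (Nat.cast_nonneg _)
  have hconn : (tightGraph (q + 1 + 4) N R t).Connected :=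
    tightGraph_connected (by omega) (by rw [h.rows]; omega)
  have hcard : q + 1 + 4 ≤ Fintype.card (Node (q + 1 + 4) N R t) := by
    rw [Node.card_eq]; omega
  have hpos := (h.ratio_le (C := ∅) (by omega) (by simp) (by simp [freeCols]) hO).1
  have habs : ∀ H : Finset (Node (q + 1 + 4) N R t), H.card ≤ q + 1 + 4 →
      q + 1 + 1 ≤ freeCols H →
      (1 - 1 / Real.exp 1) * GBC (tightGraph (q + 1 + 4) N R t) O ≤
        GBC (tightGraph (q + 1 + 4) N R t) H →
      |GBC (tightGraph (q + 1 + 4) N R t) H / GBC (tightGraph (q + 1 + 4) N R t) O -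
        (1 - 1 / Real.exp 1)| < ε := by
    intro H hH hcols hge
    -- The instance bounds the ratio from above; the approximation factor, as `hge`, bounds it from
    -- below.
    have h1 := (h.ratio_le (by omega) hH hcols hO).2
    rw [hratio] at h1
    have h2 := (le_div_iff₀ hpos).2 hge
    rw [abs_lt]
    constructor <;> linarith
  refine ⟨_, _, _, tightGraph (q + 1 + 4) N R t, q + 1 + 4, O, hconn, hcard, hO, hpos,
    exists_modifiedGreedy _ _ _, exists_unitGreedy _ hcard, fun H hH => ?_, fun H hH => ?_⟩
  · obtain ⟨h1, h2⟩ := h.freeCols_of_modifiedGreedy hH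
    exact habs H h1 h2 ((modifiedGreedyHasFactor _ _ _ _ hconn (fun _ => zero_le_one)
      (Nat.cast_nonneg _) H hH).2 O hO)
  · exact habs H hH.card_eq.le (h.freeCols_of_unitGreedy le_rfl hH)
      ((unitGreedyHasFactor _ _ _ hconn hcard H hH).2 O hO)

end MBC

/-- The factor `1 - 1/e` is the best possible approximation factor of the modified greedy algorithm
and of the greedy algorithm for unit costs, and there are unit-cost instances on which the ratio of
every possible output of either algorithm is arbitrarily close to `1 - 1/e`. -/
theorem mainTheorem2 :
    IsGreatest {ρ : ℝ | MBC.ModifiedGreedyHasFactor ρ} (1 - 1 / Real.exp 1) ∧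
    IsGreatest {ρ : ℝ | MBC.UnitGreedyHasFactor ρ} (1 - 1 / Real.exp 1) ∧
    ∀ ε : ℝ, 0 < ε →
      ∃ (V : Type) (_ : Fintype V) (_ : DecidableEq V) (G : SimpleGraph V) (k : ℕ) (O : Finset V),
        G.Connected ∧ k ≤ Fintype.card V ∧
        MBC.IsOptimal G (fun _ => 1) k O ∧ 0 < MBC.GBC G O ∧
        (∃ H, MBC.ModifiedGreedy G (fun _ => 1) k H) ∧
        (∃ H, MBC.UnitGreedy G k H) ∧
        (∀ H, MBC.ModifiedGreedy G (fun _ => 1) k H →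
          |MBC.GBC G H / MBC.GBC G O - (1 - 1 / Real.exp 1)| < ε) ∧
        (∀ H, MBC.UnitGreedy G k H →
          |MBC.GBC G H / MBC.GBC G O - (1 - 1 / Real.exp 1)| < ε) := by
  refine ⟨⟨MBC.modifiedGreedyHasFactor, fun ρ hρ => le_of_forall_pos_lt_add fun ε hε => ?_⟩,
    ⟨MBC.unitGreedyHasFactor, fun ρ hρ => le_of_forall_pos_lt_add fun ε hε => ?_⟩,
    MBC.exists_tight_instance⟩
  · obtain ⟨V, _, _, G, k, O, hG, -, hO, hpos, ⟨H, hH⟩, -, hall, -⟩ :=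
      MBC.exists_tight_instance ε hε
    have h1 := (le_div_iff₀ hpos).2
      ((hρ V G _ _ hG (fun _ => zero_le_one) (Nat.cast_nonneg k) H hH).2 O hO)
    linarith [(abs_lt.1 (hall H hH)).2]
  · obtain ⟨V, _, _, G, k, O, hG, hk, hO, hpos, -, ⟨H, hH⟩, -, hall⟩ :=
      MBC.exists_tight_instance ε hε
    have h1 := (le_div_iff₀ hpos).2 ((hρ V G k hG hk H hH).2 O hO)
    linarith [(abs_lt.1 (hall H hH)).2]
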